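/- Let $\mathcal{A}$ be an abelian category. "Subcategory" means a full additive subcategory closed under isomorphisms. Let $\mathcal{W}\subseteq\mathcal{X}$ and $\mathcal{V}\subseteq\mathcal{Y}$ be subcategories of $\mathcal{A}$. Definitions. $\mathcal{W}$ is an injective cogenerator for $\mathcal{X}$ if every object $X$ of $\mathcal{X}$ fits into a short exact sequence $0\to X\to W\to X'\to 0$ with $W$ in $\mathcal{W}$ and $X'$ in $\mathcal{X}$, and $\operatorname{Ext}^i_{\mathcal{A}}(X,W)=0$ for all $X$ in $\mathcal{X}$, $W$ in $\mathcal{W}$ and $i\geq 1$. Dually, $\mathcal{V}$ is a projective generator for $\mathcal{Y}$ if every object $Y$ of $\mathcal{Y}$ fits into a short exact sequence $0\to Y'\to V\to Y\to 0$ with $V$ in $\mathcal{V}$ and $Y'$ in $\mathcal{Y}$, and $\operatorname{Ext}^i_{\mathcal{A}}(V,Y)=0$ for all $V$ in $\mathcal{V}$, $Y$ in $\mathcal{Y}$ and $i\geq 1$. For a subcategory $\mathcal{Z}$, a complex $K$ is $\operatorname{Hom}(\mathcal{Z},-)$-exact (respectively $\operatorname{Hom}(-,\mathcal{Z})$-exact)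 if $\operatorname{Hom}_{\mathcal{A}}(Z,K)$ (respectively $\operatorname{Hom}_{\mathcal{A}}(K,Z)$) is exact for every object $Z$ of $\mathcal{Z}$. Let $\mathcal{G}(\mathcal{Z})$ be the subcategory of objects isomorphic to $\operatorname{Coker}(K_1\to K_0)$ for some exact complex $K=\cdots\to K_1\to K_0\to K_{-1}\to\cdots$ of objects of $\mathcal{Z}$ that is both $\operatorname{Hom}(\mathcal{Z},-)$-exact and $\operatorname{Hom}(-,\mathcal{Z})$-exact. Set $\mathcal{G}^0(\mathcal{Z})=\mathcal{Z}$ and $\mathcal{G}^{n+1}(\mathcal{Z})=\mathcal{G}(\mathcal{G}^n(\mathcal{Z}))$ for $n\geq 0$. A proper $\mathcal{Z}$-resolution of $M$ is an exact, $\operatorname{Hom}(\mathcal{Z},-)$-exact complex $\cdots\to Z_1\to Z_0\to M\to 0$ with all $Z_i$ in $\mathcal{Z}$; a proper $\mathcal{Z}$-coresolution of $M$ is an exact, $\operatorname{Hom}(-,\mathcal{Z})$-exact complex $0\to M\to Z^0\to Z^1\to\cdots$ with all $Z^i$ in $\mathcal{Z}$. Theorem. (a) If $\mathcal{W}$ is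 an injective cogenerator for $\mathcal{X}$ and $\mathcal{X}$ is closed under extensions, then for each $n\geq 0$ every object of $\mathcal{G}^n(\mathcal{X})$ admits a proper $\mathcal{W}$-coresolution. (b) If $\mathcal{V}$ is a projective generator for $\mathcal{Y}$ and $\mathcal{Y}$ is closed under extensions, then for each $n\geq 0$ every object of $\mathcal{G}^n(\mathcal{Y})$ admits a proper $\mathcal{V}$-resolution. -/

import Mathlib

open CategoryTheory CategoryTheory.Limits CategoryTheory.Abelian

universe v u

namespace GorensteinSubcat

section

variable {A : Type u} [Category.{v} A] [Abelian A]

/-- A "subcategory" of `A`: a full additive subcategory that is closed under isomorphisms,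
given by the property satisfied by its objects. -/
structure IsAdditiveSubcategory (P : ObjectProperty A) : Prop where
  isClosedUnderIsomorphisms : P.IsClosedUnderIsomorphisms
  containsZero : P.ContainsZero
  isClosedUnderBinaryProducts : P.IsClosedUnderBinaryProducts

/-- `P ⟂ Q`: one has `Ext^i(M, N) = 0` for all `M` in `P`, all `N` in `Q` and all `i ≥ 1`.
The Ext-groups of an arbitrary abelian category always exist in the universe `max u v`. -/
def Perp (P Q : ObjectProperty A) : Prop :=
  haveI : HasExt.{max u v} A := HasExt.standard A
  ∀ ⦃M N : A⦄, P M → Q N → ∀ i : ℕ, 1 ≤ i → Subsingleton (Ext.{max u v} M N i)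

/-- `W` is a cogenerator for `X`: every object `M` of `X` fits into a short exact sequence
`0 ⟶ M ⟶ B ⟶ M' ⟶ 0` of objects of `X` whose middle term is in `W`. -/
def IsCogenerator (W X : ObjectProperty A) : Prop :=
  ∀ ⦃M : A⦄, X M → ∃ (B M' : A) (f : M ⟶ B) (g : B ⟶ M') (w : f ≫ g = 0),
    (ShortComplex.mk f g w).ShortExact ∧ W B ∧ X B ∧ X M'

/-- `V` is a generator for `Y`: every object `M` of `Y` fits into a short exact sequence
`0 ⟶ M' ⟶ B ⟶ M ⟶ 0` of objects of `Y` whose middle term is in `V`. -/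
def IsGenerator (V Y : ObjectProperty A) : Prop :=
  ∀ ⦃M : A⦄, Y M → ∃ (M' B : A) (f : M' ⟶ B) (g : B ⟶ M) (w : f ≫ g = 0),
    (ShortComplex.mk f g w).ShortExact ∧ V B ∧ Y B ∧ Y M'

/-- `W` is an injective cogenerator for `X`. -/
structure IsInjectiveCogenerator (W X : ObjectProperty A) : Prop where
  isCogenerator : IsCogenerator W X
  perp : Perp X W

/-- `V` is a projective generator for `Y`. -/
structure IsProjectiveGenerator (V Y : ObjectProperty A) : Prop where
  isGenerator : IsGenerator V Y
  perp : Perp V Y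

/-- `K` is `Hom(P, -)`-exact: the complex of abelian groups `Hom(B, K)` is exact for every
object `B` of `P`. -/
def IsHomFromExact {ι : Type*} {c : ComplexShape ι} (P : ObjectProperty A)
    (K : HomologicalComplex A c) : Prop :=
  ∀ ⦃B : A⦄, P B →
    (((preadditiveCoyoneda.obj (Opposite.op B)).mapHomologicalComplex c).obj K).Acyclic

/-- `K` is `Hom(-, P)`-exact: the complex of abelian groups `Hom(K, B)` is exact for every
object `B` of `P`. -/
def IsHomToExact {ι : Type*} {c : ComplexShape ι} (P : ObjectProperty A)
    (K : HomologicalComplex A c) : Prop :=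
  ∀ ⦃B : A⦄, P B →
    (((preadditiveYoneda.obj B).mapHomologicalComplex c.symm).obj K.op).Acyclic

/-- A totally `P`-acyclic complex `⋯ ⟶ K₁ ⟶ K₀ ⟶ K₋₁ ⟶ ⋯`: an exact complex of objects of `P`
that is `Hom(P, -)`-exact and `Hom(-, P)`-exact. -/
structure IsTotallyAcyclic (P : ObjectProperty A) (K : ChainComplex A ℤ) : Prop where
  mem : ∀ n, P (K.X n)
  acyclic : K.Acyclic
  homFromExact : IsHomFromExact P K
  homToExact : IsHomToExact P K

/-- The Gorenstein subcategory `G(P)`: the objects isomorphic to `Coker (K₁ ⟶ K₀)` for some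
totally `P`-acyclic complex `K`. -/
def gorenstein (P : ObjectProperty A) : ObjectProperty A := fun M =>
  ∃ K : ChainComplex A ℤ, IsTotallyAcyclic P K ∧ Nonempty (M ≅ cokernel (K.d 1 0))

/-- The iterated Gorenstein subcategories: `G⁰(P) = P` and `Gⁿ⁺¹(P) = G(Gⁿ(P))`. -/
def iterGorenstein (P : ObjectProperty A) : ℕ → ObjectProperty A
  | 0 => P
  | n + 1 => gorenstein (iterGorenstein P n)

/-- A `P`-resolution of `M`: a complex `⋯ ⟶ K₁ ⟶ K₀` of objects of `P` with an augmentation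
`K₀ ⟶ M` such that the augmented complex `⋯ ⟶ K₁ ⟶ K₀ ⟶ M ⟶ 0` is exact. -/
structure Resolution (P : ObjectProperty A) (M : A) where
  complex : ChainComplex A ℕ
  mem : ∀ n, P (complex.X n)
  π : complex.X 0 ⟶ M
  d_comp_π : complex.d 1 0 ≫ π = 0
  exact : (complex.augment π d_comp_π).Acyclic

/-- A `P`-coresolution of `M`: a complex `K⁰ ⟶ K¹ ⟶ ⋯` of objects of `P` with an augmentation
`M ⟶ K⁰` such that the augmented complex `0 ⟶ M ⟶ K⁰ ⟶ K¹ ⟶ ⋯` is exact. -/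
structure Coresolution (P : ObjectProperty A) (M : A) where
  complex : CochainComplex A ℕ
  mem : ∀ n, P (complex.X n)
  ι : M ⟶ complex.X 0
  ι_comp_d : ι ≫ complex.d 0 1 = 0
  exact : (complex.augment ι ι_comp_d).Acyclic

/-- A `P`-resolution is proper if the augmented resolution is `Hom(P, -)`-exact. -/
def Resolution.IsProper {P : ObjectProperty A} {M : A} (R : Resolution P M) : Prop :=
  IsHomFromExact P (R.complex.augment R.π R.d_comp_π)

/-- A `P`-coresolution is proper if the augmented coresolution is `Hom(-, P)`-exact. -/
def Coresolution.IsProper {P : ObjectProperty A} {M : A} (R : Coresolution P M) : Prop :=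
  IsHomToExact P (R.complex.augment R.ι R.ι_comp_d)

/-- The objects of `A` that admit a proper `P`-resolution. -/
def properRes (P : ObjectProperty A) : ObjectProperty A := fun M =>
  ∃ R : Resolution P M, R.IsProper

/-- The objects of `A` that admit a proper `P`-coresolution. -/
def properCores (P : ObjectProperty A) : ObjectProperty A := fun M =>
  ∃ R : Coresolution P M, R.IsProper

end

end GorensteinSubcat

namespace GorensteinSubcat

/-! ### Proper short exact sequences: pushouts, horseshoe, splicing -/

section ProperSequences

variable {A : Type u} [Category.{v} A] [Abelian A]

/-! The core is `HasCoresolution.trans`: a `Hom(-, W)`-exact coresolution whose terms have proper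
`W`-coresolutions can be replaced by one with terms in `W`. Given this, induct on n. For n = 0 the
cogenerator sequences are proper because `Ext¹` vanishes. For n + 1, the half of a totally acyclic
complex to the right of M coresolves M by objects of `Gⁿ(X)`; it is `Hom(-, W)`-exact because `W ≤ X
≤ Gⁿ(X)`, and its terms are covered by induction. For `trans`, let 0 → M → K → N → 0 start the
coresolution, and 0 → K → B → L → 0 that of K. The pushout C of N and B over K is the cokernel of M
→ B and an extension of L by N. Pushing C out along the next step N → K₁ gives C → P with P an
extension of L by K₁; the horseshoe lemma coresolves P, so C satisfies the hypothesis on M again.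
Part (b) applies the same lemmas to opposites in `Aᵒᵖ`. -/

/-- A short exact sequence `0 ⟶ X₁ ⟶ X₂ ⟶ X₃ ⟶ 0` that is `Hom(-, W)`-exact. -/
structure IsProperShortExact (W : ObjectProperty A) (S : ShortComplex A) : Prop where
  shortExact : S.ShortExact
  extend : ∀ ⦃B : A⦄, W B → ∀ t : S.X₁ ⟶ B, ∃ s : S.X₂ ⟶ B, S.f ≫ s = t

/-- `M` has a `Hom(-, W)`-exact coresolution by objects of `Q`: there is a class of objects
containing `M` in which one can take cosyzygies indefinitely. -/
def HasCoresolution (W Q : ObjectProperty A) : ObjectProperty A := fun M =>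
  ∃ C : ObjectProperty A, C M ∧ ∀ ⦃N⦄, C N →
    ∃ S : ShortComplex A, IsProperShortExact W S ∧ S.X₁ = N ∧ Q S.X₂ ∧ C S.X₃

lemma HasCoresolution.step {W Q : ObjectProperty A} {M : A} (h : HasCoresolution W Q M) :
    ∃ S : ShortComplex A, IsProperShortExact W S ∧ S.X₁ = M ∧ Q S.X₂ ∧
      HasCoresolution W Q S.X₃ := by
  obtain ⟨C, hM, hC⟩ := h
  obtain ⟨S, hS, e, h₂, h₃⟩ := hC hM
  exact ⟨S, hS, e, h₂, C, h₃, hC⟩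

/-- The cokernel `L` of a monomorphism `f : N ⟶ C` is also the cokernel of the pushout of `f`
along any morphism `a : N ⟶ K`. -/
lemma IsProperShortExact.pushout {W : ObjectProperty A} {N C L K P : A} {f : N ⟶ C} {g : C ⟶ L}
    {w : f ≫ g = 0} (h : IsProperShortExact W (ShortComplex.mk f g w)) {a : N ⟶ K}
    {c : C ⟶ P} {k : K ⟶ P} (sq : IsPushout f a c k) :
    ∃ (g' : P ⟶ L) (w' : k ≫ g' = 0), IsProperShortExact W (ShortComplex.mk k g' w') := by
  have := h.shortExact.mono_f
  have := h.shortExact.epi_g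
  dsimp at *
  have hk : Mono k := Abelian.mono_inr_of_isColimit _ _ sq.isColimit
  let g' : P ⟶ L := sq.desc g 0 (by rw [w, comp_zero])
  have hc : c ≫ g' = g := sq.inl_desc _ _ _
  have w' : k ≫ g' = 0 := sq.inr_desc _ _ _
  have hg : Epi g' := epi_of_epi_fac hc
  refine ⟨g', w', ⟨⟨?_⟩, ?_⟩⟩
  · refine ShortComplex.exact_of_g_is_cokernel _
      (CokernelCofork.IsColimit.ofπ' _ _ fun {Z} t ht => ?_)
    dsimp at t ht
    have ht' : f ≫ c ≫ t = 0 := by rw [sq.w_assoc, ht, comp_zero]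
    refine ⟨h.shortExact.exact.desc (c ≫ t) ht', sq.hom_ext ?_ ?_⟩
    · rw [reassoc_of% hc]
      exact h.shortExact.exact.g_desc _ _
    · rw [reassoc_of% w', zero_comp, ht]
  · intro B hB t
    obtain ⟨s, hs⟩ := h.extend hB (a ≫ t)
    exact ⟨sq.desc s t hs, sq.inr_desc _ _ _⟩

/-- If `0 ⟶ M ⟶ K ⟶ N ⟶ 0` and `0 ⟶ K ⟶ B ⟶ L ⟶ 0` are `Hom(-, W)`-exact, then so is
`0 ⟶ M ⟶ B ⟶ C ⟶ 0`, where `C` is the pushout of `N` and `B` over `K`. -/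
lemma IsProperShortExact.comp {W : ObjectProperty A} {M K N B L : A} {i : M ⟶ K} {p : K ⟶ N}
    {w : i ≫ p = 0} (h : IsProperShortExact W (ShortComplex.mk i p w))
    {f : K ⟶ B} {g : B ⟶ L} {w₁ : f ≫ g = 0}
    (h₁ : IsProperShortExact W (ShortComplex.mk f g w₁)) :
    ∃ w', IsProperShortExact W (ShortComplex.mk (i ≫ f) (pushout.inl f p) w') := by
  have := h.shortExact.mono_f
  have := h.shortExact.epi_g
  have := h₁.shortExact.mono_f
  dsimp at *
  have w' : (i ≫ f) ≫ pushout.inl f p = 0 := by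
    rw [Category.assoc, pushout.condition, reassoc_of% w, zero_comp]
  refine ⟨w', ⟨⟨?_⟩, ?_⟩⟩
  · refine ShortComplex.exact_of_g_is_cokernel _ (CokernelCofork.IsColimit.ofπ' _ _ fun {Z} k hk => ?_)
    dsimp at k hk
    rw [Category.assoc] at hk
    refine ⟨pushout.desc k (h.shortExact.exact.desc (f ≫ k) hk)
      (h.shortExact.exact.g_desc _ _).symm, pushout.inl_desc _ _ _⟩
  · intro B' hB t
    obtain ⟨s, hs⟩ := h.extend hB t
    obtain ⟨r, hr⟩ := h₁.extend hB s
    exact ⟨r, by dsimp at *; simp [hr, hs]⟩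

/-- One step of the horseshoe lemma. -/
lemma IsProperShortExact.horseshoe {W : ObjectProperty A}
    {K P L B₁ K' B₂ L' : A} {i : K ⟶ P} {p : P ⟶ L} {w : i ≫ p = 0}
    (h : IsProperShortExact W (ShortComplex.mk i p w))
    {f₁ : K ⟶ B₁} {g₁ : B₁ ⟶ K'} {w₁ : f₁ ≫ g₁ = 0}
    (h₁ : IsProperShortExact W (ShortComplex.mk f₁ g₁ w₁)) (hB₁ : W B₁)
    {f₂ : L ⟶ B₂} {g₂ : B₂ ⟶ L'} {w₂ : f₂ ≫ g₂ = 0}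
    (h₂ : IsProperShortExact W (ShortComplex.mk f₂ g₂ w₂)) :
    ∃ (P' : A) (f : P ⟶ B₁ ⊞ B₂) (g : B₁ ⊞ B₂ ⟶ P') (w₃ : f ≫ g = 0)
      (i' : K' ⟶ P') (p' : P' ⟶ L') (w' : i' ≫ p' = 0),
      IsProperShortExact W (ShortComplex.mk f g w₃) ∧
      IsProperShortExact W (ShortComplex.mk i' p' w') := by
  -- Properness against `B₁` in `W` replaces injectivity of `B₁`.
  obtain ⟨e, he⟩ := h.extend hB₁ f₁
  have := h.shortExact.mono_f
  have := h.shortExact.epi_g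
  have := h₁.shortExact.mono_f
  have := h₁.shortExact.epi_g
  have := h₂.shortExact.mono_f
  have := h₂.shortExact.epi_g
  dsimp at *
  let f : P ⟶ B₁ ⊞ B₂ := biprod.lift e (p ≫ f₂)
  let T₁ := ShortComplex.mk i p w
  let T₂ := ShortComplex.mk (biprod.inl : B₁ ⟶ B₁ ⊞ B₂) biprod.snd (by simp)
  have hT₂ : T₂.ShortExact :=
    (ShortComplex.Splitting.ofHasBinaryBiproduct B₁ B₂).shortExact
  let φ : T₁ ⟶ T₂ :=
    { τ₁ := f₁
      τ₂ := f
      τ₃ := f₂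
      comm₁₂ := by
        apply biprod.hom_ext <;> simp [T₁, T₂, f, he, reassoc_of% w]
      comm₂₃ := by simp [T₁, T₂, f] }
  have : Mono φ.τ₁ := by dsimp [φ]; infer_instance
  have : Mono φ.τ₃ := by dsimp [φ]; infer_instance
  have : Mono T₁.f := by dsimp [T₁]; infer_instance
  have hf : Mono f := by
    have := hT₂.mono_f
    exact ShortComplex.mono_τ₂_of_exact_of_mono φ h.shortExact.exact
  let i' : K' ⟶ cokernel f := h₁.shortExact.exact.desc (biprod.inl ≫ cokernel.π f) (by
    have := φ.comm₁₂
    dsimp [φ, T₁, T₂] at this ⊢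
    rw [reassoc_of% this, cokernel.condition, comp_zero])
  have hi' : g₁ ≫ i' = biprod.inl ≫ cokernel.π f := h₁.shortExact.exact.g_desc _ _
  let p' : cokernel f ⟶ L' := cokernel.desc f (biprod.snd ≫ g₂) (by simp [f, w₂])
  have hp' : cokernel.π f ≫ p' = biprod.snd ≫ g₂ := cokernel.π_desc _ _ _
  have w' : i' ≫ p' = 0 := by
    rw [← cancel_epi g₁, reassoc_of% hi', hp']; simp
  have hp'' : Epi p' := by
    have : Epi (cokernel.π f ≫ p') := by rw [hp']; infer_instance
    exact epi_of_epi (cokernel.π f) p'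
  -- Use `g₁ ≫ t` on `B₁`; the component `-y` on `B₂` is chosen so that the sum vanishes on `f`.
  have key : ∀ ⦃B : A⦄, W B → ∀ t : K' ⟶ B, ∃ s : cokernel f ⟶ B, i' ≫ s = t := by
    intro B hB t
    have h0 : i ≫ e ≫ g₁ ≫ t = 0 := by rw [reassoc_of% he, reassoc_of% w₁, zero_comp]
    obtain ⟨y, hy⟩ := h₂.extend hB (h.shortExact.exact.desc (e ≫ g₁ ≫ t) h0)
    have hy' : p ≫ f₂ ≫ y = e ≫ g₁ ≫ t := by
      dsimp at hy
      rw [hy]; exact h.shortExact.exact.g_desc _ _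
    refine ⟨cokernel.desc f (biprod.desc (g₁ ≫ t) (-y)) (by simp [f, hy']), ?_⟩
    rw [← cancel_epi g₁, reassoc_of% hi']; simp
  -- Diagram chase, with the pullback along `g₁` lifting an element of `K'` to `b` in `B₁`: if (b,
  -- 0) = f(z), then z comes from `K`, so b lies in the image of `f₁` and dies in `K'`.
  have hi'' : Mono i' := by
    refine Preadditive.mono_of_cancel_zero _ fun {Z} x hx => ?_
    let y : pullback x g₁ ⟶ B₁ := pullback.snd x g₁
    have hy : pullback.fst x g₁ ≫ x = y ≫ g₁ := pullback.condition
    have h0 : (y ≫ biprod.inl) ≫ cokernel.π f = 0 := by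
      rw [Category.assoc, ← hi', ← reassoc_of% hy, hx, comp_zero]
    obtain ⟨z, hz⟩ : ∃ z : _ ⟶ P, z ≫ f = y ≫ biprod.inl :=
      ⟨(ShortComplex.exact_cokernel f).lift _ h0, (ShortComplex.exact_cokernel f).lift_f _ _⟩
    have hz₁ : z ≫ e = y := by simpa [f] using hz =≫ biprod.fst
    have hz₂ : z ≫ p = 0 := by
      rw [← cancel_mono f₂]
      simpa [f] using hz =≫ biprod.snd
    obtain ⟨k, hk⟩ : ∃ k : _ ⟶ K, k ≫ i = z :=
      ⟨h.shortExact.exact.lift z hz₂, h.shortExact.exact.lift_f _ _⟩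
    rw [← cancel_epi (pullback.fst x g₁), hy, ← hz₁, ← hk, Category.assoc, Category.assoc,
      reassoc_of% he, w₁, comp_zero, comp_zero]
  refine ⟨cokernel f, f, cokernel.π f, cokernel.condition f, i', p', w', ⟨⟨?_⟩, ?_⟩, ⟨⟨?_⟩, key⟩⟩
  · exact ShortComplex.exact_cokernel f
  · intro B hB t
    obtain ⟨s, hs⟩ := h₁.extend hB (i ≫ t)
    have h0 : i ≫ (t - e ≫ s) = 0 := by
      dsimp at hs
      rw [Preadditive.comp_sub, reassoc_of% he, hs, sub_self]
    obtain ⟨r, hr⟩ := h₂.extend hB (h.shortExact.exact.desc _ h0)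
    have hr' : p ≫ f₂ ≫ r = t - e ≫ s := by
      dsimp at hr
      rw [hr]; exact h.shortExact.exact.g_desc _ _
    exact ⟨biprod.desc s r, by simp [f, hr']⟩
  · refine ShortComplex.exact_of_g_is_cokernel _ (CokernelCofork.IsColimit.ofπ' _ _ fun {Z} k hk => ?_)
    dsimp at k hk
    have h0 : f₂ ≫ biprod.inr ≫ cokernel.π f ≫ k = 0 := by
      have : f ≫ cokernel.π f ≫ k = 0 := by simp
      have h1 : biprod.inl ≫ cokernel.π f ≫ k = 0 := by
        rw [← reassoc_of% hi', hk, comp_zero]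
      rw [← cancel_epi p, comp_zero, ← this]
      simp [f, biprod.lift_eq, h1]
    refine ⟨h₂.shortExact.exact.desc _ h0, ?_⟩
    have : g₂ ≫ h₂.shortExact.exact.desc _ h0 = _ := h₂.shortExact.exact.g_desc _ _
    dsimp
    rw [← cancel_epi (cokernel.π f), reassoc_of% hp', this]
    apply biprod.hom_ext'
    · simp [← reassoc_of% hi', hk]
    · simp

lemma HasCoresolution.of_proper_extension {W : ObjectProperty A}
    (hW : ∀ ⦃B₁ B₂ : A⦄, W B₁ → W B₂ → W (B₁ ⊞ B₂))
    {S : ShortComplex A} (hS : IsProperShortExact W S)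
    (h₁ : HasCoresolution W W S.X₁) (h₃ : HasCoresolution W W S.X₃) :
    HasCoresolution W W S.X₂ := by
  -- Middle terms of such extensions form a class closed under cosyzygies, by the horseshoe step.
  refine ⟨fun P => ∃ T : ShortComplex A, IsProperShortExact W T ∧ HasCoresolution W W T.X₁ ∧
    HasCoresolution W W T.X₃ ∧ T.X₂ = P, ⟨S, hS, h₁, h₃, rfl⟩, ?_⟩
  rintro _ ⟨⟨i, p, w⟩, hT, hK, hL, rfl⟩
  obtain ⟨⟨f₁, g₁, w₁⟩, hT₁, rfl, hB₁, hK'⟩ := hK.step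
  obtain ⟨⟨f₂, g₂, w₂⟩, hT₂, rfl, hB₂, hL'⟩ := hL.step
  obtain ⟨P', f, g, w₃, i', p', w', h, h'⟩ := hT.horseshoe hT₁ hB₁ hT₂
  exact ⟨_, h, rfl, hW hB₁ hB₂, _, h', hK', hL', rfl⟩

/-- If `M` has a proper coresolution by objects admitting proper `W`-coresolutions, then `M` has
a proper `W`-coresolution. -/
lemma HasCoresolution.trans {W : ObjectProperty A}
    (hW : ∀ ⦃B₁ B₂ : A⦄, W B₁ → W B₂ → W (B₁ ⊞ B₂)) {M : A}
    (hM : HasCoresolution W (HasCoresolution W W) M) : HasCoresolution W W M := by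
  refine ⟨HasCoresolution W (HasCoresolution W W), hM, ?_⟩
  clear hM M
  intro M hM
  obtain ⟨⟨i, p, w⟩, hS, rfl, hK, hN⟩ := hM.step
  obtain ⟨⟨f, g, w₁⟩, hT, rfl, hB, hL⟩ := hK.step
  obtain ⟨w', hC⟩ := hS.comp hT
  refine ⟨_, hC, rfl, hB, ?_⟩
  obtain ⟨q, w₂, hNC⟩ := hT.pushout (IsPushout.of_hasPushout f p)
  obtain ⟨⟨a, b, w₃⟩, hN', rfl, hK₁, hN''⟩ := hN.step
  -- Read one way, this pushout embeds `C` with cokernel `N''`; flipped, it is an extension of `L`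
  -- by `K₁`.
  have sq := IsPushout.of_hasPushout a (pushout.inr f p)
  obtain ⟨_, _, h₂⟩ := hN'.pushout sq
  obtain ⟨_, _, h₁⟩ := hNC.pushout sq.flip
  obtain ⟨C, hC, hC'⟩ := hN''
  refine ⟨fun X => C X ∨ X = pushout f p, Or.inr rfl, ?_⟩
  rintro X (hX | rfl)
  · obtain ⟨S, hS, e, hQ, h⟩ := hC' hX
    exact ⟨S, hS, e, hQ, Or.inl h⟩
  · have hP := of_proper_extension hW h₁ hK₁ hL
    exact ⟨_, h₂, rfl, hP, Or.inl hC⟩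

end ProperSequences
-- Passing between complexes and iterated proper sequences
section Complexes

variable {A : Type u} [Category.{v} A] [Abelian A]

lemma HasCoresolution.of_iso {W Q : ObjectProperty A} {M M' : A} (e : M ≅ M')
    (h : HasCoresolution W Q M) : HasCoresolution W Q M' := by
  obtain ⟨S, hS, rfl, h₂, C, hC, hC'⟩ := h.step
  refine ⟨fun N => C N ∨ N = M', Or.inr rfl, ?_⟩
  rintro N (hN | rfl)
  · obtain ⟨S, hS, e, hQ, h⟩ := hC' hN
    exact ⟨S, hS, e, hQ, Or.inl h⟩
  · refine ⟨ShortComplex.mk (e.inv ≫ S.f) S.g (by simp), ⟨?_, fun B hB t => ?_⟩, rfl, h₂,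
      Or.inl hC⟩
    · exact ShortComplex.shortExact_of_iso
        (ShortComplex.isoMk e (Iso.refl _) (Iso.refl _) (by simp) (by simp)) hS.shortExact
    · obtain ⟨s, hs⟩ := hS.extend hB (e.hom ≫ t)
      exact ⟨s, by simp [hs]⟩

lemma yoneda_exactAt_iff {ι : Type*} {c : ComplexShape ι} (K : HomologicalComplex A c) (B : A)
    {i j k : ι} (hi : c.prev j = i) (hk : c.next j = k) :
    (((preadditiveYoneda.obj B).mapHomologicalComplex c.symm).obj K.op).ExactAt j ↔
      ∀ x : K.X j ⟶ B, K.d i j ≫ x = 0 → ∃ y : K.X k ⟶ B, K.d j k ≫ y = x := by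
  rw [HomologicalComplex.exactAt_iff' _ k j i (show c.symm.prev j = k from hk)
    (show c.symm.next j = i from hi), ShortComplex.ab_exact_iff]
  rfl

lemma coyoneda_exactAt_iff {ι : Type*} {c : ComplexShape ι} (K : HomologicalComplex A c) (B : A)
    {i j k : ι} (hi : c.prev j = i) (hk : c.next j = k) :
    (((preadditiveCoyoneda.obj (Opposite.op B)).mapHomologicalComplex c).obj K).ExactAt j ↔
      ∀ x : B ⟶ K.X j, x ≫ K.d j k = 0 → ∃ y : B ⟶ K.X i, y ≫ K.d i j = x := by
  rw [HomologicalComplex.exactAt_iff' _ i j k hi hk, ShortComplex.ab_exact_iff]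
  rfl

lemma exact_comp_of_epi_of_mono {M' M B N N' : A} {f : M ⟶ B} {g : B ⟶ N} {w : f ≫ g = 0}
    (h : (ShortComplex.mk f g w).Exact) (q : M' ⟶ M) [Epi q] (u : N ⟶ N') [Mono u]
    {a : M' ⟶ B} {b : B ⟶ N'} (ha : a = q ≫ f) (hb : b = g ≫ u) (w' : a ≫ b = 0) :
    (ShortComplex.mk a b w').Exact := by
  subst ha hb
  let φ : ShortComplex.mk (q ≫ f) g (by simp [w]) ⟶ ShortComplex.mk f g w :=
    { τ₁ := q, τ₂ := 𝟙 _, τ₃ := 𝟙 _ }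
  let ψ : ShortComplex.mk (q ≫ f) g (by simp [w]) ⟶ ShortComplex.mk (q ≫ f) (g ≫ u) w' :=
    { τ₁ := 𝟙 _, τ₂ := 𝟙 _, τ₃ := u }
  have : Epi φ.τ₁ := by dsimp [φ]; infer_instance
  have : Mono ψ.τ₃ := by dsimp [ψ]; infer_instance
  have : IsIso φ.τ₂ := by dsimp [φ]; infer_instance
  have : IsIso φ.τ₃ := by dsimp [φ]; infer_instance
  have : IsIso ψ.τ₁ := by dsimp [ψ]; infer_instance
  have : IsIso ψ.τ₂ := by dsimp [ψ]; infer_instance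
  rw [← ShortComplex.exact_iff_of_epi_of_isIso_of_mono ψ,
    ShortComplex.exact_iff_of_epi_of_isIso_of_mono φ]
  exact h

/-- Exactness at `j` makes the left map mono. These are the sequences into which an exact complex
decomposes. -/
lemma shortExact_cokernel_of_acyclic {K : ChainComplex A ℤ} (hK : K.Acyclic) {i j k : ℤ}
    (hij : j + 1 = i) (hjk : k + 1 = j) :
    (ShortComplex.mk (cokernel.desc (K.d i j) (K.d j k) (K.d_comp_d i j k))
      (cokernel.π (K.d j k)) (by ext; simp)).ShortExact := by
  have hex : (K.sc' i j k).Exact := by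
    rw [← K.exactAt_iff' i j k (by simp [hij]) (by simp [← hjk])]
    exact hK j
  have : Mono (cokernel.desc (K.d i j) (K.d j k) (K.d_comp_d i j k)) :=
    hex.mono_cokernelDesc
  refine ⟨?_⟩
  refine ShortComplex.exact_of_g_is_cokernel _
      (CokernelCofork.IsColimit.ofπ' _ _ fun {Z} t ht => ?_)
  dsimp at t ht
  exact ⟨cokernel.desc _ t (by rw [← cokernel.π_desc (K.d i j) (K.d j k) (K.d_comp_d i j k),
    Category.assoc, ht, comp_zero]), by simp⟩

lemma hasCoresolution_of_gorenstein {W P : ObjectProperty A} (hWP : W ≤ P) {M : A}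
    (hM : gorenstein P M) : HasCoresolution W P M := by
  obtain ⟨K, hK, ⟨e⟩⟩ := hM
  refine HasCoresolution.of_iso e.symm
    ⟨fun N => ∃ i j : ℤ, j + 1 = i ∧ N = cokernel (K.d i j), ⟨1, 0, by simp, rfl⟩, ?_⟩
  rintro _ ⟨i, j, hij, rfl⟩
  obtain ⟨k, hjk⟩ : ∃ k : ℤ, k + 1 = j := ⟨j - 1, by simp⟩
  refine ⟨_, ⟨shortExact_cokernel_of_acyclic hK.acyclic hij hjk, fun B hB t => ?_⟩, rfl,
    hK.mem k, j, k, hjk, rfl⟩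
  dsimp at t
  -- A map from the cokernel to `B` is a cocycle on `K.X j`, hence a coboundary from `K.X k`.
  obtain ⟨y, hy⟩ := (yoneda_exactAt_iff K B (i := i) (k := k) (by simp [hij])
    (by simp [← hjk])).1 (hK.homToExact (hWP _ hB) j) (cokernel.π (K.d i j) ≫ t) (by simp)
  exact ⟨y, by ext; simpa using hy⟩

/-- The cokernel embeds in the next term `K.X l` as cycles, so `Hom(B, -)`-exactness at `l` provides
the lift. -/
lemma exists_lift_cokernel {V P : ObjectProperty A} (hVP : V ≤ P) {K : ChainComplex A ℤ}
    (hK : IsTotallyAcyclic P K) {j k : ℤ} (hjk : k + 1 = j) {B : A} (hB : V B)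
    (t : B ⟶ cokernel (K.d j k)) : ∃ s : B ⟶ K.X k, s ≫ cokernel.π (K.d j k) = t := by
  obtain ⟨l, hkl⟩ : ∃ l : ℤ, l + 1 = k := ⟨k - 1, by simp⟩
  have hm := (shortExact_cokernel_of_acyclic hK.acyclic hjk hkl).mono_f
  dsimp at hm
  have hd : cokernel.desc (K.d j k) (K.d k l) (K.d_comp_d j k l) ≫ K.d l (l - 1) = 0 := by
    ext; simp
  obtain ⟨y, hy⟩ := (coyoneda_exactAt_iff K B (j := l) (i := k) (k := l - 1)
    (by simp [hkl]) (by simp)).1 (hK.homFromExact (hVP _ hB) l)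
    (t ≫ cokernel.desc (K.d j k) (K.d k l) (K.d_comp_d j k l))
    (by rw [Category.assoc, hd, comp_zero])
  refine ⟨y, ?_⟩
  rw [← cancel_mono (cokernel.desc (K.d j k) (K.d k l) (K.d_comp_d j k l))]
  simpa using hy

/-- In `Aᵒᵖ` the terms of `K` in degrees `≥ 0`, which resolve `M`, become a coresolution. -/
lemma hasCoresolution_op_of_gorenstein {V P : ObjectProperty A} (hVP : V ≤ P) {M : A}
    (hM : gorenstein P M) : HasCoresolution V.op P.op (Opposite.op M) := by
  obtain ⟨K, hK, ⟨e⟩⟩ := hM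
  refine HasCoresolution.of_iso e.op
    ⟨fun N => ∃ j k : ℤ, k + 1 = j ∧ N = Opposite.op (cokernel (K.d j k)),
      ⟨1, 0, by simp, rfl⟩, ?_⟩
  rintro _ ⟨j, k, hjk, rfl⟩
  refine ⟨_, ⟨(shortExact_cokernel_of_acyclic hK.acyclic rfl hjk).op, fun B hB t => ?_⟩, rfl,
    hK.mem k, _, j, rfl, rfl⟩
  obtain ⟨s, hs⟩ := exists_lift_cokernel hVP hK hjk hB t.unop
  exact ⟨s.op, Quiver.Hom.unop_inj hs⟩

lemma le_gorenstein (P : ObjectProperty A) : P ≤ gorenstein P := by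
  intro M hM
  -- Differentials alternate between identity and zero, so `K` stays exact under every `Hom`; the
  -- parity makes `d 1 0 = 0`, with cokernel `M`.
  let d : ℤ → ℤ → (M ⟶ M) := fun i j => if j + 1 = i ∧ ¬ Even j then 𝟙 M else 0
  let K : ChainComplex A ℤ :=
    { X := fun _ => M
      d := d
      shape := fun i j h => if_neg fun h' => h h'.1
      d_comp_d' := by
        rintro i j k (rfl : j + 1 = i) (rfl : k + 1 = j)
        by_cases h : Even k <;> simp [d, h] }
  have hd : ∀ j : ℤ, (d (j + 1 + 1) (j + 1) = 𝟙 M ∧ d (j + 1) j = 0) ∨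
      (d (j + 1 + 1) (j + 1) = 0 ∧ d (j + 1) j = 𝟙 M) := fun j => by
    by_cases h : Even j <;> simp [d, h]
  have hp : ∀ j : ℤ, (ComplexShape.down ℤ).prev (j + 1) = j + 1 + 1 := fun j => by simp
  have hn : ∀ j : ℤ, (ComplexShape.down ℤ).next (j + 1) = j := fun j => by simp
  have hj : ∀ {p : ℤ → Prop}, (∀ j, p (j + 1)) → ∀ j, p j := fun h j => by simpa using h (j - 1)
  refine ⟨K, ⟨fun _ => hM, hj fun j => ?_, fun B _ => hj fun j => ?_, fun B _ => hj fun j => ?_⟩,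
    ⟨(cokernelZeroIsoTarget (X := M) (Y := M)).symm ≪≫ cokernelIsoOfEq (by simp [K, d])⟩⟩
  · rw [K.exactAt_iff' _ _ _ (hp j) (hn j)]
    rcases hd j with ⟨h, h'⟩ | ⟨h, h'⟩
    · rw [ShortComplex.exact_iff_epi _ h']
      change Epi (d (j + 1 + 1) (j + 1))
      rw [h]
      infer_instance
    · rw [ShortComplex.exact_iff_mono _ h]
      change Mono (d (j + 1) j)
      rw [h']
      infer_instance
  · rw [coyoneda_exactAt_iff K B (hp j) (hn j)]
    change ∀ x : B ⟶ M, x ≫ d (j + 1) j = 0 → ∃ y : B ⟶ M, y ≫ d (j + 1 + 1) (j + 1) = x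
    intro x hx
    rcases hd j with ⟨h, h'⟩ | ⟨h, h'⟩
    · exact ⟨x, by rw [h, Category.comp_id]⟩
    · exact ⟨0, by rw [zero_comp, ← hx, h', Category.comp_id]⟩
  · rw [yoneda_exactAt_iff K B (hp j) (hn j)]
    change ∀ x : M ⟶ B, d (j + 1 + 1) (j + 1) ≫ x = 0 → ∃ y : M ⟶ B, d (j + 1) j ≫ y = x
    intro x hx
    rcases hd j with ⟨h, h'⟩ | ⟨h, h'⟩
    · exact ⟨0, by rw [comp_zero, ← hx, h, Category.id_comp]⟩
    · exact ⟨x, by rw [h', Category.id_comp]⟩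

lemma properCores_of_sequence {W : ObjectProperty A} (M B : ℕ → A) (f : ∀ n, M n ⟶ B n)
    (g : ∀ n, B n ⟶ M (n + 1)) (w : ∀ n, f n ≫ g n = 0)
    (h : ∀ n, IsProperShortExact W (ShortComplex.mk (f n) (g n) (w n))) (hB : ∀ n, W (B n)) :
    properCores W (M 0) := by
  have hf : ∀ n, Mono (f n) := fun n => (h n).shortExact.mono_f
  have hg : ∀ n, Epi (g n) := fun n => (h n).shortExact.epi_g
  have w' : ∀ n, (g n ≫ f (n + 1)) ≫ g (n + 1) ≫ f (n + 2) = 0 := fun n => by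
    simp [reassoc_of% (w (n + 1))]
  let K : CochainComplex A ℕ := CochainComplex.of B (fun n => g n ≫ f (n + 1)) w'
  have hK : ∀ n, K.d n (n + 1) = g n ≫ f (n + 1) := fun n =>
    CochainComplex.of_d B (fun n => g n ≫ f (n + 1)) n
  have hιd : f 0 ≫ K.d 0 1 = 0 := by
    rw [hK 0, reassoc_of% (w 0), zero_comp]
  have hn : ∀ n : ℕ, (ComplexShape.up ℕ).next n = n + 1 := fun n => by simp
  have hp : ∀ n : ℕ, (ComplexShape.up ℕ).prev (n + 1) = n := fun n => by simp
  -- Degree 0 has no predecessor, so `prev` defaults to 0 and the incoming differential is zero. In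
  -- the augmented complex `M 0` sits in degree 0 and `B n` in degree `n + 1`.
  have hp₀ : (ComplexShape.up ℕ).prev 0 = 0 := by simp
  refine ⟨⟨K, hB, f 0, hιd, ?_⟩, fun B' hB' => ?_⟩
  · rintro (_ | _ | n)
    · rw [HomologicalComplex.exactAt_iff' _ _ _ _ hp₀ (hn _), ShortComplex.exact_iff_mono _ rfl]
      exact hf 0
    · rw [HomologicalComplex.exactAt_iff' _ _ _ _ (hp 0) (hn _)]
      exact exact_comp_of_epi_of_mono (h 0).shortExact.exact (𝟙 (M 0)) (f 1)
        (Category.id_comp _).symm (hK 0) _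
    · rw [HomologicalComplex.exactAt_iff' _ _ _ _ (hp _) (hn _)]
      exact exact_comp_of_epi_of_mono (h (n + 1)).shortExact.exact (g n) (f (n + 2))
        (hK n) (hK (n + 1)) _
  · have key : ∀ n (x : B n ⟶ B'), f n ≫ x = 0 → ∃ y : B (n + 1) ⟶ B',
        (g n ≫ f (n + 1)) ≫ y = x := fun n x hx => by
      obtain ⟨y, hy⟩ := (h (n + 1)).extend hB' ((h n).shortExact.exact.desc x hx)
      refine ⟨y, ?_⟩
      rw [Category.assoc]
      exact (congrArg (g n ≫ ·) hy).trans ((h n).shortExact.exact.g_desc _ _)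
    -- Cancelling the epi `g n` reduces this to `key`.
    have key' : ∀ n (x : B (n + 1) ⟶ B'), (g n ≫ f (n + 1)) ≫ x = 0 →
        ∃ y : B (n + 2) ⟶ B', (g (n + 1) ≫ f (n + 2)) ≫ y = x := fun n x hx =>
      key (n + 1) x (by rwa [← cancel_epi (g n), comp_zero, ← Category.assoc])
    rintro (_ | _ | n)
    · rw [yoneda_exactAt_iff _ _ hp₀ (hn _)]
      exact fun x _ => (h 0).extend hB' x
    · rw [yoneda_exactAt_iff _ _ (hp 0) (hn _)]
      intro x hx
      obtain ⟨y, hy⟩ := key 0 x hx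
      exact ⟨y, (congrArg (· ≫ y) (hK 0)).trans hy⟩
    · rw [yoneda_exactAt_iff _ _ (hp _) (hn _)]
      intro x hx
      obtain ⟨y, hy⟩ := key' n x ((congrArg (· ≫ x) (hK n)).symm.trans hx)
      exact ⟨y, (congrArg (· ≫ y) (hK (n + 1))).trans hy⟩

lemma properRes_of_sequence {V : ObjectProperty A} (M B : ℕ → A) (f : ∀ n, M (n + 1) ⟶ B n)
    (g : ∀ n, B n ⟶ M n) (w : ∀ n, f n ≫ g n = 0)
    (h : ∀ n, (ShortComplex.mk (f n) (g n) (w n)).ShortExact) (hB : ∀ n, V (B n))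
    (hl : ∀ n ⦃B' : A⦄, V B' → ∀ t : B' ⟶ M n, ∃ s : B' ⟶ B n, s ≫ g n = t) :
    properRes V (M 0) := by
  have hf : ∀ n, Mono (f n) := fun n => (h n).mono_f
  have hg : ∀ n, Epi (g n) := fun n => (h n).epi_g
  have w' : ∀ n, (g (n + 2) ≫ f (n + 1)) ≫ g (n + 1) ≫ f n = 0 := fun n => by
    simp [reassoc_of% (w (n + 1))]
  let K : ChainComplex A ℕ := ChainComplex.of B (fun n => g (n + 1) ≫ f n) w'
  have hK : ∀ n, K.d (n + 1) n = g (n + 1) ≫ f n := fun n =>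
    ChainComplex.of_d B (fun n => g (n + 1) ≫ f n) n
  have hdπ : K.d 1 0 ≫ g 0 = 0 := by
    rw [hK 0, Category.assoc, w 0, comp_zero]
  have hp : ∀ n : ℕ, (ComplexShape.down ℕ).prev n = n + 1 := fun n => by simp
  have hn : ∀ n : ℕ, (ComplexShape.down ℕ).next (n + 1) = n := fun n => by simp
  have hn₀ : (ComplexShape.down ℕ).next 0 = 0 := by simp
  have haug : ∀ n, (K.augment (g 0) hdπ).d (n + 2) (n + 1) = g (n + 1) ≫ f n := fun n =>
    (ChainComplex.augment_d_succ_succ _ _ _ _ _).trans (hK n)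
  refine ⟨⟨K, hB, g 0, hdπ, ?_⟩, fun B' hB' => ?_⟩
  · rintro (_ | _ | n)
    · rw [HomologicalComplex.exactAt_iff' _ _ _ _ (hp _) hn₀, ShortComplex.exact_iff_epi _ rfl]
      exact hg 0
    · rw [HomologicalComplex.exactAt_iff' _ _ _ _ (hp _) (hn 0)]
      exact exact_comp_of_epi_of_mono (h 0).exact (g 1) (𝟙 (M 0))
        (haug 0) (Category.comp_id _).symm _
    · rw [HomologicalComplex.exactAt_iff' _ _ _ _ (hp _) (hn _)]
      exact exact_comp_of_epi_of_mono (h (n + 1)).exact (g (n + 2)) (f n)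
        (haug (n + 1)) (haug n) _
  · have key : ∀ n (x : B' ⟶ B n), x ≫ g n = 0 → ∃ y : B' ⟶ B (n + 1),
        y ≫ g (n + 1) ≫ f n = x := fun n x hx => by
      obtain ⟨y, hy⟩ := hl (n + 1) hB' ((h n).exact.lift x hx)
      refine ⟨y, ?_⟩
      rw [← Category.assoc]
      exact (congrArg (· ≫ f n) hy).trans ((h n).exact.lift_f _ _)
    have key' : ∀ n (x : B' ⟶ B (n + 1)), x ≫ g (n + 1) ≫ f n = 0 →
        ∃ y : B' ⟶ B (n + 2), y ≫ g (n + 2) ≫ f (n + 1) = x := fun n x hx =>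
      key (n + 1) x (by rwa [← cancel_mono (f n), zero_comp, Category.assoc])
    rintro (_ | _ | n)
    · rw [coyoneda_exactAt_iff _ _ (hp _) hn₀]
      exact fun x _ => hl 0 hB' x
    · rw [coyoneda_exactAt_iff _ _ (hp _) (hn 0)]
      intro x hx
      obtain ⟨y, hy⟩ := key 0 x hx
      exact ⟨y, (congrArg (y ≫ ·) (haug 0)).trans hy⟩
    · rw [coyoneda_exactAt_iff _ _ (hp _) (hn _)]
      intro x hx
      obtain ⟨y, hy⟩ := key' n x ((congrArg (x ≫ ·) (haug n)).symm.trans hx)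
      exact ⟨y, (congrArg (y ≫ ·) (haug (n + 1))).trans hy⟩

/-- Dependent choice, iterating `step` on the subtype of objects with a coresolution. -/
lemma HasCoresolution.exists_sequence {W : ObjectProperty A} {M₀ : A}
    (hM₀ : HasCoresolution W W M₀) :
    ∃ (M B : ℕ → A) (f : ∀ n, M n ⟶ B n) (g : ∀ n, B n ⟶ M (n + 1)) (w : ∀ n, f n ≫ g n = 0),
      M 0 = M₀ ∧ (∀ n, IsProperShortExact W (ShortComplex.mk (f n) (g n) (w n))) ∧
        ∀ n, W (B n) := by
  have step : ∀ M : { M : A // HasCoresolution W W M }, ∃ (N : { M : A // HasCoresolution W W M })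
      (B : A) (f : M.1 ⟶ B) (g : B ⟶ N.1) (w : f ≫ g = 0),
      IsProperShortExact W (ShortComplex.mk f g w) ∧ W B := by
    rintro ⟨M, hM⟩
    obtain ⟨S, hS, rfl, h₂, h₃⟩ := hM.step
    exact ⟨⟨_, h₃⟩, _, S.f, S.g, S.zero, hS, h₂⟩
  choose N B f g w h hB using step
  let M : ℕ → { M : A // HasCoresolution W W M } := fun n => Nat.rec ⟨M₀, hM₀⟩ (fun _ => N) n
  exact ⟨fun n => (M n).1, fun n => B (M n), fun n => f (M n), fun n => g (M n),
    fun n => w (M n), rfl, fun n => h (M n), fun n => hB (M n)⟩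

lemma HasCoresolution.properCores {W : ObjectProperty A} {M : A}
    (hM : HasCoresolution W W M) : properCores W M := by
  obtain ⟨M, B, f, g, w, rfl, h, hB⟩ := hM.exists_sequence
  exact properCores_of_sequence M B f g w h hB

lemma HasCoresolution.properRes {V : ObjectProperty A} {M : A}
    (hM : HasCoresolution V.op V.op (Opposite.op M)) : properRes V M := by
  obtain ⟨N, B, f, g, w, hN, h, hB⟩ := hM.exists_sequence
  obtain rfl : (N 0).unop = M := by rw [hN]
  refine properRes_of_sequence (fun n => (N n).unop) (fun n => (B n).unop) (fun n => (g n).unop)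
    (fun n => (f n).unop) (fun n => Quiver.Hom.op_inj (w n)) (fun n => (h n).shortExact.unop) hB
    fun n B' hB' t => ?_
  obtain ⟨s, hs⟩ := (h n).extend (B := Opposite.op B') hB' t.op
  exact ⟨s.unop, Quiver.Hom.op_inj hs⟩

end Complexes

/-! ### Base case of the induction and closure properties -/

section Iteration

variable {A : Type u} [Category.{v} A] [Abelian A]

lemma HasCoresolution.mono {W Q Q' : ObjectProperty A} (hQ : Q ≤ Q') {M : A}
    (h : HasCoresolution W Q M) : HasCoresolution W Q' M := by
  obtain ⟨C, hM, hC⟩ := h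
  refine ⟨C, hM, fun N hN => ?_⟩
  obtain ⟨S, hS, e, h₂, h₃⟩ := hC hN
  exact ⟨S, hS, e, hQ _ h₂, h₃⟩

lemma IsInjectiveCogenerator.hasCoresolution {W X : ObjectProperty A}
    (h : IsInjectiveCogenerator W X) : X ≤ HasCoresolution W W := by
  intro M hM
  refine ⟨X, hM, fun N hN => ?_⟩
  obtain ⟨B, N', f, g, w, hS, hB, -, hN'⟩ := h.isCogenerator hN
  refine ⟨_, ⟨hS, fun B' hB' t => ?_⟩, rfl, hB, hN'⟩
  let : HasExt.{max u v} A := HasExt.standard A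
  have : Subsingleton (Ext.{max u v} N' B' 1) := h.perp hN' hB' 1 le_rfl
  -- The obstruction to extending `t` over `B` lies in `Ext¹(N', B') = 0`.
  obtain ⟨x, hx⟩ := Ext.contravariant_sequence_exact₁ hS B' (Ext.mk₀ t) (add_zero 1)
    (Subsingleton.elim _ _)
  obtain ⟨s, rfl⟩ := (Ext.mk₀_bijective _ _).2 x
  rw [Ext.mk₀_comp_mk₀] at hx
  exact ⟨s, (Ext.mk₀_bijective _ _).1 hx⟩

lemma IsProjectiveGenerator.hasCoresolution {V Y : ObjectProperty A}
    (h : IsProjectiveGenerator V Y) : Y.op ≤ HasCoresolution V.op V.op := by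
  intro M hM
  refine ⟨Y.op, hM, fun N hN => ?_⟩
  obtain ⟨N', B, f, g, w, hS, hB, -, hN'⟩ := h.isGenerator hN
  refine ⟨_, ⟨hS.op, fun B' hB' t => ?_⟩, rfl, hB, hN'⟩
  let : HasExt.{max u v} A := HasExt.standard A
  have : Subsingleton (Ext.{max u v} B'.unop N' 1) := h.perp hB' hN' 1 le_rfl
  -- The obstruction to lifting `t.unop` lies in `Ext¹(B'.unop, N') = 0`.
  obtain ⟨x, hx⟩ := Ext.covariant_sequence_exact₃ B'.unop hS (Ext.mk₀ t.unop) (zero_add 1)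
    (Subsingleton.elim _ _)
  obtain ⟨s, rfl⟩ := (Ext.mk₀_bijective _ _).2 x
  rw [Ext.mk₀_comp_mk₀] at hx
  exact ⟨s.op, Quiver.Hom.unop_inj ((Ext.mk₀_bijective _ _).1 hx)⟩

lemma IsAdditiveSubcategory.biprod {P : ObjectProperty A} (hP : IsAdditiveSubcategory P)
    {B₁ B₂ : A} (h₁ : P B₁) (h₂ : P B₂) : P (B₁ ⊞ B₂) := by
  have := hP.isClosedUnderIsomorphisms
  have := hP.isClosedUnderBinaryProducts
  exact P.prop_of_iso (biprod.isoProd B₁ B₂).symm (P.prop_prod B₁ B₂ h₁ h₂)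

lemma IsAdditiveSubcategory.op_biprod {P : ObjectProperty A} (hP : IsAdditiveSubcategory P)
    {B₁ B₂ : Aᵒᵖ} (h₁ : P.op B₁) (h₂ : P.op B₂) : P.op (B₁ ⊞ B₂) := by
  have := hP.isClosedUnderIsomorphisms
  let e : B₁.unop ⊞ B₂.unop ≅ (B₁ ⊞ B₂).unop :=
    { hom := biprod.desc biprod.fst.unop biprod.snd.unop
      inv := biprod.lift biprod.inl.unop biprod.inr.unop
      hom_inv_id := by
        ext <;> simp [← unop_comp]
      inv_hom_id := by
        rw [biprod.lift_desc, ← unop_comp, ← unop_comp, ← unop_add, biprod.total, unop_id] }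
  exact P.prop_of_iso e (hP.biprod h₁ h₂)

/-- Turns `Hom`-exactness against `Gⁿ(P)` into `Hom`-exactness against `P` and its subcategories. -/
lemma le_iterGorenstein (P : ObjectProperty A) (n : ℕ) : P ≤ iterGorenstein P n := by
  induction n with
  | zero => exact le_rfl
  | succ n ih => exact ih.trans (le_gorenstein _)

end Iteration

end GorensteinSubcat

theorem mainTheorem5 {A : Type u} [Category.{v} A] [Abelian A]
    (X Y W V : ObjectProperty A)
    (hX : GorensteinSubcat.IsAdditiveSubcategory X)
    (hY : GorensteinSubcat.IsAdditiveSubcategory Y)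
    (hW : GorensteinSubcat.IsAdditiveSubcategory W)
    (hV : GorensteinSubcat.IsAdditiveSubcategory V)
    (hWX : W ≤ X) (hVY : V ≤ Y) :
    (GorensteinSubcat.IsInjectiveCogenerator W X → X.IsClosedUnderExtensions →
      ∀ n : ℕ, GorensteinSubcat.iterGorenstein X n ≤ GorensteinSubcat.properCores W) ∧
    (GorensteinSubcat.IsProjectiveGenerator V Y → Y.IsClosedUnderExtensions →
      ∀ n : ℕ, GorensteinSubcat.iterGorenstein Y n ≤ GorensteinSubcat.properRes V) := by
  open GorensteinSubcat in
  refine ⟨fun h _ n => ?_, fun h _ n => ?_⟩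
  · suffices iterGorenstein X n ≤ HasCoresolution W W from fun M hM => (this M hM).properCores
    induction n with
    | zero => exact h.hasCoresolution
    | succ n ih =>
      exact fun M hM => HasCoresolution.trans (fun _ _ => hW.biprod)
        ((hasCoresolution_of_gorenstein (hWX.trans (le_iterGorenstein X n)) hM).mono ih)
  · suffices (iterGorenstein Y n).op ≤ HasCoresolution V.op V.op from
      fun M hM => (this (Opposite.op M) hM).properRes
    induction n with
    | zero => exact h.hasCoresolution
    | succ n ih =>
      exact fun M hM => HasCoresolution.trans (fun _ _ => hV.op_biprod)
        ((hasCoresolution_op_of_gorenstein (hVY.trans (le_iterGorenstein Y n)) hM).mono ih)
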